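/- Let $H$ be a complex Hilbert space; "projection" means orthogonal projection onto a closed subspace. For bounded $T\colon E\to F$ between Hilbert spaces let $\|T\|_C=\inf\{\|T-K\| : K\colon E\to F \text{ compact}\}$ be the norm of $T$ modulo compact operators. A pair $(Q,P)$ of projections in $H$ is called a Fredholm pair if the operator $\operatorname{Ran}(Q)\to\operatorname{Ran}(P)$, $x\mapsto Px$, is Fredholm; $\operatorname{ind}(Q,P)$ denotes its index $\dim\ker-\dim\operatorname{coker}$. Theorem. For $i=0,1$ let $H=Y_i\oplus Z_i$ be an orthogonal decomposition into closed subspaces and let $S_i$ be the projection onto $Y_i$. Assume that $1-S_1-S_0$ is compact. Let $G_i\colon Y_i\to Z_i$ be bounded linear operators with $\|G_0\|_C\,\|G_1\|_C<1$, and let $P_i$ be the projection onto the graph $\{x+G_ix : x\in Y_i\}\subseteq H$. Then: 1. $(P_1,1-P_0)$ is a Fredholm pair; 2. $(S_1,1-S_0)$ is a Fredholm pair, and $\operatorname{ind}(P_1,1-P_0)=\operatorname{ind}(S_1,1-S_0)$. -/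

import Mathlib

noncomputable section

section General

variable {E F : Type*} [NormedAddCommGroup E] [NormedSpace ℂ E]
  [NormedAddCommGroup F] [NormedSpace ℂ F]

/-- The Calkin (essential) norm `‖T‖_C` of a bounded operator `T : E → F`: the norm of its class in
the quotient of the bounded operators by the compact operators. For `E = F` this quotient is the
Calkin algebra of `E`. -/
def calkinNorm (T : E →L[ℂ] F) : ℝ :=
  ‖(Submodule.Quotient.mk T : (E →L[ℂ] F) ⧸ compactOperator (RingHom.id ℂ) E F)‖

theorem calkinNorm_eq_infDist (T : E →L[ℂ] F) :
    calkinNorm T =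
      Metric.infDist T (compactOperator (RingHom.id ℂ) E F : Set (E →L[ℂ] F)) :=
  QuotientAddGroup.norm_mk (S := (compactOperator (RingHom.id ℂ) E F).toAddSubgroup) T

/-- The index `dim Ker T - dim Coker T` (meaningful when `T` is Fredholm). -/
def fredholmIndex (T : E →L[ℂ] F) : ℤ :=
  (Module.finrank ℂ (LinearMap.ker (T : E →ₗ[ℂ] F)) : ℤ) -
    (Module.finrank ℂ (F ⧸ LinearMap.range (T : E →ₗ[ℂ] F)) : ℤ)

end General

section Pairs

variable {H : Type*} [NormedAddCommGroup H] [InnerProductSpace ℂ H]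

/-- The operator `Ran Q → Ran P`, `x ↦ P x`. -/
def pairOperator (Q P : H →L[ℂ] H) :
    LinearMap.range (Q : H →ₗ[ℂ] H) →L[ℂ] LinearMap.range (P : H →ₗ[ℂ] H) :=
  (P ∘L (LinearMap.range (Q : H →ₗ[ℂ] H)).subtypeL).codRestrict
    (LinearMap.range (P : H →ₗ[ℂ] H)) (fun x => ⟨(x : H), rfl⟩)

/-- `(Q, P)` is a Fredholm pair of orthogonal projections: `P : Ran Q → Ran P` is Fredholm. -/
structure IsFredholmPair [CompleteSpace H] (Q P : H →L[ℂ] H) : Prop where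
  isStarProjection_left : IsStarProjection Q
  isStarProjection_right : IsStarProjection P
  isFredholm : (pairOperator Q P).IsFredholm

/-- The index `ind (Q, P)` of a Fredholm pair. -/
def pairIndex (Q P : H →L[ℂ] H) : ℤ :=
  fredholmIndex (pairOperator Q P)

/-- The graph `{x + G x | x ∈ Y}` of `G : Y → Yᗮ`, as a subspace of `H`. -/
def graphSubspace {Y : Submodule ℂ H} (G : Y →L[ℂ] Yᗮ) : Submodule ℂ H :=
  LinearMap.range (Y.subtype + Yᗮ.subtype ∘ₗ (G : Y →ₗ[ℂ] Yᗮ))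

theorem mem_graphSubspace {Y : Submodule ℂ H} (G : Y →L[ℂ] Yᗮ) (v : H) :
    v ∈ graphSubspace G ↔ ∃ x : Y, (x : H) + (G x : H) = v :=
  Iff.rfl

theorem isClosed_graphSubspace {Y : Submodule ℂ H} [Y.HasOrthogonalProjection]
    (G : Y →L[ℂ] Yᗮ) : IsClosed (graphSubspace G : Set H) := by
  have h : (graphSubspace G : Set H) =
      {v | v = (Y.orthogonalProjectionOnto v : H) + (G (Y.orthogonalProjectionOnto v) : H)} := by
    ext v
    constructor
    · rintro ⟨x, rfl⟩
      have h1 : Y.orthogonalProjectionOnto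
          ((Y.subtype + Yᗮ.subtype ∘ₗ (G : Y →ₗ[ℂ] Yᗮ)) x) = x := by
        change Y.orthogonalProjectionOnto ((x : H) + ((G x : Yᗮ) : H)) = x
        rw [map_add, Submodule.orthogonalProjectionOnto_mem_subspace_eq_self,
          Submodule.orthogonalProjectionOnto_eq_zero_iff.2 (G x).2, add_zero]
      change _ = _
      rw [h1]
      rfl
    · intro hv
      exact ⟨Y.orthogonalProjectionOnto v, hv.symm⟩
  rw [h]
  exact isClosed_eq continuous_id (by fun_prop)

/-- The graph is closed, so it has an orthogonal projection. -/
instance instHasOrthogonalProjectionGraphSubspace [CompleteSpace H] {Y : Submodule ℂ H}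
    [Y.HasOrthogonalProjection] (G : Y →L[ℂ] Yᗮ) : (graphSubspace G).HasOrthogonalProjection :=
  haveI : CompleteSpace (graphSubspace G) := (isClosed_graphSubspace G).completeSpace_coe
  inferInstance

end Pairs

end

/-!
Write `S_i` for the projection onto `Y_i`. The graph of `G₁` is parametrized by `Y₁` through
`x ↦ x + G₁ x`, and the orthogonal complement of the graph of `G₀` is identified with `Y₀ᗮ` through
`v ↦ (1 - S₀) v - G₀ S₀ v`, a map which vanishes on the graph itself. Under these two isomorphisms
the operator of the pair `(P₁, 1 - P₀)` becomes (`pairOperator_graph_eq`)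
`B : Y₁ → Y₀ᗮ`, `B x = (1 - S₀) (x + G₁ x) - G₀ S₀ (x + G₁ x)`.

Since `1 - S₁ - S₀` is compact, `S₀` is compact on `Y₁` and `1 - S₀` is compact on `Y₁ᗮ`. Modulo
compact operators this leaves `B = T - G₀ S₀ G₁`, where `T : Y₁ → Y₀ᗮ` is the restriction of
`1 - S₀`. The operators `G_i` may themselves be changed by compact operators, so that
`‖G₀ S₀ G₁‖ ≤ ‖G₀‖ ‖G₁‖ < 1`. The restriction `T' : Y₀ᗮ → Y₁` of `S₁` is a contraction and an
inverse of `T` modulo compact operators. So `T' B` and `B T'` are of the form `1 - C` plus a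
compact operator, with `‖C‖ < 1`, and are therefore Fredholm of index zero
(`isFredholm_and_fredholmIndex_unit_add_compact`). It follows that `B` is Fredholm, and additivity
of the index (`fredholmIndex_comp`) gives `ind B = -ind T'`
(`isFredholm_and_fredholmIndex_of_inverse_mod_compact`). The right-hand side does not depend on the
`G_i`. Comparing with `G₀ = G₁ = 0`, for which the graphs are `Y₀` and `Y₁`, proves the theorem.
-/

open Submodule
open scoped LinearMap.FiniteRangeSetoid

/-! ### Indices of linear maps -/

section Algebra

variable {V W X : Type*} [AddCommGroup V] [Module ℂ V] [AddCommGroup W] [Module ℂ W]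
  [AddCommGroup X] [Module ℂ X]

/-- Additivity of the index under composition, by rank-nullity along the exact sequence
`0 → Ker T → Ker ST → Ker S → Coker T → Coker ST → Coker S → 0`. -/
theorem finrank_ker_sub_finrank_coker_comp (S : W →ₗ[ℂ] X) (T : V →ₗ[ℂ] W)
    [FiniteDimensional ℂ (LinearMap.ker (S ∘ₗ T))]
    [FiniteDimensional ℂ (LinearMap.ker S)]
    [FiniteDimensional ℂ (W ⧸ LinearMap.range T)]
    [FiniteDimensional ℂ (X ⧸ LinearMap.range (S ∘ₗ T))] :
    (Module.finrank ℂ (LinearMap.ker (S ∘ₗ T)) : ℤ)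
        - Module.finrank ℂ (X ⧸ LinearMap.range (S ∘ₗ T)) =
      ((Module.finrank ℂ (LinearMap.ker S) : ℤ) - Module.finrank ℂ (X ⧸ LinearMap.range S)) +
      ((Module.finrank ℂ (LinearMap.ker T) : ℤ) - Module.finrank ℂ (W ⧸ LinearMap.range T)) := by
  -- `φ`, `ψ`, `χ`, `ω` are the arrows from `Ker ST` onwards.
  let φ : LinearMap.ker (S ∘ₗ T) →ₗ[ℂ] LinearMap.ker S :=
    T.restrict (fun x hx => by simpa using hx)
  let ψ : LinearMap.ker S →ₗ[ℂ] (W ⧸ LinearMap.range T) :=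
    (LinearMap.range T).mkQ ∘ₗ (LinearMap.ker S).subtype
  let χ : (W ⧸ LinearMap.range T) →ₗ[ℂ] (X ⧸ LinearMap.range (S ∘ₗ T)) :=
    Submodule.mapQ _ _ S (by rintro _ ⟨x, rfl⟩; exact ⟨x, rfl⟩)
  let ω : (X ⧸ LinearMap.range (S ∘ₗ T)) →ₗ[ℂ] (X ⧸ LinearMap.range S) :=
    Submodule.factor (LinearMap.range_comp_le_range T S)
  have hφ : Module.finrank ℂ (LinearMap.ker φ) = Module.finrank ℂ (LinearMap.ker T) := by
    refine LinearEquiv.finrank_eq (LinearEquiv.ofLinearMap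
      (((LinearMap.ker (S ∘ₗ T)).subtype ∘ₗ (LinearMap.ker φ).subtype).codRestrict _ ?_)
      ((((LinearMap.ker T).subtype).codRestrict (LinearMap.ker (S ∘ₗ T)) ?_).codRestrict _ ?_)
      ?_ ?_)
    · intro x
      exact congrArg Subtype.val x.2
    · intro x
      have : T x = 0 := x.2
      simp [this]
    · intro x
      exact Subtype.ext x.2
    · ext x; rfl
    · ext x; rfl
  have hψ : LinearMap.ker ψ = LinearMap.range φ := by
    ext w
    simp only [ψ, LinearMap.mem_ker, LinearMap.comp_apply, Submodule.mkQ_apply,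
      Submodule.Quotient.mk_eq_zero, Submodule.subtype_apply]
    constructor
    · rintro ⟨x, hx⟩
      have hw : S w = 0 := w.2
      exact ⟨⟨x, by simp [hx, hw]⟩, Subtype.ext hx⟩
    · rintro ⟨x, rfl⟩
      exact ⟨x, rfl⟩
  have hχ : LinearMap.ker χ = LinearMap.range ψ := by
    ext w
    obtain ⟨w, rfl⟩ := Submodule.mkQ_surjective _ w
    constructor
    · intro h
      obtain ⟨x, hx⟩ := (Submodule.Quotient.mk_eq_zero _).1
        (show (LinearMap.range (S ∘ₗ T)).mkQ (S w) = 0 from h)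
      refine ⟨⟨w - T x, ?_⟩, ?_⟩
      · simpa [sub_eq_zero] using hx.symm
      · exact (Submodule.Quotient.eq _).2 ⟨-x, by simp⟩
    · rintro ⟨x, hx⟩
      rw [← hx]
      have : S x = 0 := x.2
      simp [ψ, χ, this]
  have hω : LinearMap.ker ω = LinearMap.range χ := by
    ext w
    obtain ⟨w, rfl⟩ := Submodule.mkQ_surjective _ w
    constructor
    · intro h
      obtain ⟨x, hx⟩ := (Submodule.Quotient.mk_eq_zero _).1
        (show (LinearMap.range S).mkQ w = 0 from h)
      exact ⟨(LinearMap.range T).mkQ x, by simp [χ, ← hx]⟩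
    · rintro ⟨x, hx⟩
      obtain ⟨x, rfl⟩ := Submodule.mkQ_surjective _ x
      rw [← hx]
      exact (Submodule.Quotient.mk_eq_zero _).2 ⟨x, rfl⟩
  have hω' : LinearMap.range ω = ⊤ :=
    LinearMap.range_eq_top.2 (Submodule.factor_surjective _)
  have h1 := φ.finrank_range_add_finrank_ker
  have h2 := ψ.finrank_range_add_finrank_ker
  have h3 := χ.finrank_range_add_finrank_ker
  have h4 := ω.finrank_range_add_finrank_ker
  rw [hφ] at h1
  rw [hψ] at h2
  rw [hχ] at h3
  rw [hω, hω', finrank_top] at h4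
  omega

/-- `1 + F` has index zero when `F` has finite rank: writing `F = i f` through its range, `f` and
`-i` identify the kernel and the cokernel of `1 + i f` with those of the endomorphism `1 + f i` of
the finite-dimensional space `Ran F`. -/
theorem finrank_ker_id_add_eq_finrank_coker {F : V →ₗ[ℂ] V} (hF : F.HasFiniteRange) :
    Module.finrank ℂ (LinearMap.ker (LinearMap.id + F)) =
      Module.finrank ℂ (V ⧸ LinearMap.range (LinearMap.id + F)) := by
  have : FiniteDimensional ℂ (LinearMap.range F) := .of_fg hF
  let i : LinearMap.range F →ₗ[ℂ] V := (LinearMap.range F).subtype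
  let f : V →ₗ[ℂ] LinearMap.range F := F.rangeRestrict
  have hif : ∀ x, i (f x) = F x := fun x => rfl
  let g : LinearMap.range F →ₗ[ℂ] LinearMap.range F := LinearMap.id + f ∘ₗ i
  have e₁ : Module.finrank ℂ (LinearMap.ker (LinearMap.id + F)) =
      Module.finrank ℂ (LinearMap.ker g) := by
    refine LinearEquiv.finrank_eq (LinearEquiv.ofLinearMap (f.restrict ?_) ((-i).restrict ?_) ?_ ?_)
    · intro x hx
      have hx : x + i (f x) = 0 := hx
      change f x + f (i (f x)) = 0
      rw [← map_add, hx, map_zero]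
    · intro r hr
      have hr : r + f (i r) = 0 := hr
      change - i r + i (f (- i r)) = 0
      rw [map_neg, map_neg, ← neg_add, ← map_add, hr, map_zero, neg_zero]
    · ext ⟨r, hr⟩
      have hr : r + f (i r) = 0 := hr
      change ((f (- i r) : LinearMap.range F) : V) = r
      rw [map_neg, ← eq_neg_of_add_eq_zero_left hr]
    · ext ⟨x, hx⟩
      have hx : x + i (f x) = 0 := hx
      exact (eq_neg_of_add_eq_zero_left hx).symm
  have e₂ : Module.finrank ℂ (V ⧸ LinearMap.range (LinearMap.id + F)) =
      Module.finrank ℂ (LinearMap.range F ⧸ LinearMap.range g) := by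
    refine LinearEquiv.finrank_eq (LinearEquiv.ofLinearMap
      (Submodule.mapQ _ _ f ?_) (Submodule.mapQ _ _ (-i) ?_) ?_ ?_)
    · rintro _ ⟨x, rfl⟩
      exact ⟨f x, by simp [g, ← hif]⟩
    · rintro _ ⟨r, rfl⟩
      refine ⟨-i r, ?_⟩
      simp [g, ← hif, add_comm]
    · refine Submodule.linearMap_qext _ (LinearMap.ext fun r => ?_)
      refine (Submodule.Quotient.eq _).2 ⟨-r, ?_⟩
      simp [g]
      abel
    · refine Submodule.linearMap_qext _ (LinearMap.ext fun x => ?_)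
      refine (Submodule.Quotient.eq _).2 ⟨-x, ?_⟩
      simp [← hif]
      abel
  have h1 := g.finrank_range_add_finrank_ker
  have h2 := (LinearMap.range g).finrank_quotient_add_finrank
  omega

end Algebra

/-! ### Fredholm operators -/

section Fredholm

variable {D E F G : Type*} [NormedAddCommGroup D] [NormedSpace ℂ D]
  [NormedAddCommGroup E] [NormedSpace ℂ E]
  [NormedAddCommGroup F] [NormedSpace ℂ F] [NormedAddCommGroup G] [NormedSpace ℂ G]

theorem fredholmIndex_comp {S : F →L[ℂ] G} {T : E →L[ℂ] F} (hS : S.IsFredholm)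
    (hT : T.IsFredholm) (hST : (S ∘L T).IsFredholm) :
    fredholmIndex (S ∘L T) = fredholmIndex S + fredholmIndex T := by
  have := hST.finite_ker
  have := hS.finite_ker
  have : FiniteDimensional ℂ (F ⧸ LinearMap.range (T : E →ₗ[ℂ] F)) := hT.finite_coker
  have : FiniteDimensional ℂ (G ⧸ LinearMap.range ((S : F →ₗ[ℂ] G) ∘ₗ (T : E →ₗ[ℂ] F))) :=
    hST.finite_coker
  have : FiniteDimensional ℂ (LinearMap.ker ((S : F →ₗ[ℂ] G) ∘ₗ (T : E →ₗ[ℂ] F))) :=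
    hST.finite_ker
  exact finrank_ker_sub_finrank_coker_comp (S : F →ₗ[ℂ] G) (T : E →ₗ[ℂ] F)

theorem ContinuousLinearMap.IsFredholm.comp {S : F →L[ℂ] G} {T : E →L[ℂ] F}
    (hS : S.IsFredholm) (hT : T.IsFredholm) : (S ∘L T).IsFredholm := by
  obtain ⟨s, hs⟩ := hS.exists_isQuasiInverse
  obtain ⟨t, ht⟩ := hT.exists_isQuasiInverse
  exact .of_isQuasiInverse (v := t ∘L s) (ht.comp hs)

theorem ContinuousLinearEquiv.isFredholm (e : E ≃L[ℂ] F) :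
    (e : E →L[ℂ] F).IsFredholm :=
  .of_isQuasiInverse (v := (e.symm : F →L[ℂ] E)) e.toLinearEquiv.isQuasiInverse

theorem fredholmIndex_equiv (e : E ≃L[ℂ] F) : fredholmIndex (e : E →L[ℂ] F) = 0 := by
  have h1 : LinearMap.ker ((e : E →L[ℂ] F) : E →ₗ[ℂ] F) = ⊥ := e.toLinearEquiv.ker
  have h2 : LinearMap.range ((e : E →L[ℂ] F) : E →ₗ[ℂ] F) = ⊤ := e.toLinearEquiv.range
  rw [fredholmIndex, h1, h2]
  simp [Module.finrank_zero_of_subsingleton]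

/-- If `L B` and `B R` are Fredholm then `B` has a left and a right inverse modulo finite rank, and
these agree modulo finite rank. -/
theorem ContinuousLinearMap.IsFredholm.of_comp_of_comp
    {L : F →L[ℂ] G} {B : E →L[ℂ] F} {R : D →L[ℂ] E}
    (hL : (L ∘L B).IsFredholm) (hR : (B ∘L R).IsFredholm) : B.IsFredholm := by
  obtain ⟨l, hl, -⟩ := hL.exists_isQuasiInverse
  obtain ⟨r, -, hr⟩ := hR.exists_isQuasiInverse
  let l' : F →ₗ[ℂ] E := (l : G →ₗ[ℂ] E) ∘ₗ (L : F →ₗ[ℂ] G)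
  let r' : F →ₗ[ℂ] E := (R : D →ₗ[ℂ] E) ∘ₗ (r : F →ₗ[ℂ] D)
  let b : E →ₗ[ℂ] F := B
  have hl' : l' ∘ₗ b ≈ LinearMap.id := hl
  have hr' : b ∘ₗ r' ≈ LinearMap.id := hr
  have h : l' ≈ r' := by
    calc
      l' = l' ∘ₗ .id := by simp
      _ ≈ l' ∘ₗ (b ∘ₗ r') := by grw [hr']
      _ = (l' ∘ₗ b) ∘ₗ r' := (LinearMap.comp_assoc _ _ _).symm
      _ ≈ .id ∘ₗ r' := by grw [hl']
      _ = r' := by simp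
  refine .of_isQuasiInverse (v := l ∘L L) ⟨hl', ?_⟩
  change b ∘ₗ l' ≈ LinearMap.id
  grw [h]
  exact hr'

theorem isFredholm_and_fredholmIndex_id_add_of_hasFiniteRange {K : E →L[ℂ] E}
    (hK : (K : E →ₗ[ℂ] E).HasFiniteRange) :
    (ContinuousLinearMap.id ℂ E + K).IsFredholm ∧
      fredholmIndex (ContinuousLinearMap.id ℂ E + K) = 0 := by
  have h : ((ContinuousLinearMap.id ℂ E + K : E →L[ℂ] E) : E →ₗ[ℂ] E) ≈ LinearMap.id := by
    rw [LinearMap.FiniteRangeSetoid.equiv_iff_hasFiniteRange]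
    have : ((ContinuousLinearMap.id ℂ E + K : E →L[ℂ] E) : E →ₗ[ℂ] E) - LinearMap.id =
        (K : E →ₗ[ℂ] E) :=
      LinearMap.ext fun x => add_sub_cancel_left x (K x)
    rwa [this]
  refine ⟨.of_isQuasiInverse (v := ContinuousLinearMap.id ℂ E) ⟨?_, ?_⟩, ?_⟩
  · exact h
  · exact h
  · rw [fredholmIndex, sub_eq_zero]
    exact_mod_cast finrank_ker_id_add_eq_finrank_coker hK

end Fredholm

/-! ### Compact perturbations in Hilbert spaces -/

section Hilbert

variable {E F : Type*} [NormedAddCommGroup E] [InnerProductSpace ℂ E]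
  [NormedAddCommGroup F] [InnerProductSpace ℂ F]

/-- Compact operators into a Hilbert space are norm limits of finite-rank ones: compose with the
projection onto the span of a finite `ε`-net of the image of the unit ball. -/
theorem IsCompactOperator.exists_hasFiniteRange_norm_sub_le {K : E →L[ℂ] F}
    (hK : IsCompactOperator K) {ε : ℝ} (hε : 0 < ε) :
    ∃ R : E →L[ℂ] F, (R : E →ₗ[ℂ] F).HasFiniteRange ∧ ‖K - R‖ ≤ ε := by
  obtain ⟨C, hC, hKC⟩ := hK.image_closedBall_subset_compact (f := (K : E →ₗ[ℂ] F)) 1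
  obtain ⟨t, ht, hcov⟩ := Metric.totallyBounded_iff.1 hC.totallyBounded ε hε
  let M : Submodule ℂ F := Submodule.span ℂ t
  have : FiniteDimensional ℂ M := FiniteDimensional.span_of_finite ℂ ht
  refine ⟨M.starProjection ∘L K, ?_, ?_⟩
  · refine LinearMap.HasFiniteRange.comp_right (v := (M.starProjection : F →ₗ[ℂ] F)) ?_ _
    rw [LinearMap.HasFiniteRange]
    have := Submodule.range_starProjection M
    rw [this]
    exact Submodule.fg_span ht
  · refine ContinuousLinearMap.opNorm_le_of_unit_norm hε.le fun x hx => ?_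
    have hKx : K x ∈ C := hKC ⟨x, by simp [hx], rfl⟩
    obtain ⟨y, hy, hxy⟩ := Set.mem_iUnion₂.1 (hcov hKx)
    rw [mem_ball_iff_norm] at hxy
    have hle := M.starProjection_minimal (K x)
    calc ‖(K - M.starProjection ∘L K) x‖ = ‖K x - M.starProjection (K x)‖ := rfl
      _ = ⨅ w : M, ‖K x - w‖ := hle
      _ ≤ ‖K x - y‖ := ciInf_le ⟨0, by rintro _ ⟨w, rfl⟩; positivity⟩
          (⟨y, Submodule.subset_span hy⟩ : M)
      _ ≤ ε := hxy.le

/-- An invertible operator plus a compact one is Fredholm of index zero. Up to a perturbation small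
enough to be absorbed by the invertible part, the compact operator has finite rank. -/
theorem isFredholm_and_fredholmIndex_unit_add_compact [CompleteSpace E] (V : (E →L[ℂ] E)ˣ)
    {K : E →L[ℂ] E} (hK : IsCompactOperator K) :
    ((V : E →L[ℂ] E) + K).IsFredholm ∧ fredholmIndex ((V : E →L[ℂ] E) + K) = 0 := by
  obtain ⟨ε, hε, hball⟩ := Metric.isOpen_iff.1 Units.isOpen (V : E →L[ℂ] E) V.isUnit
  obtain ⟨R, hR, hKR⟩ := hK.exists_hasFiniteRange_norm_sub_le (half_pos hε)
  obtain ⟨U, hU⟩ : IsUnit ((V : E →L[ℂ] E) + (K - R)) := by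
    refine hball ?_
    rw [mem_ball_iff_norm, add_sub_cancel_left]
    linarith
  let e : E ≃L[ℂ] E := ContinuousLinearEquiv.unitsEquiv ℂ E U
  have hdec : (V : E →L[ℂ] E) + K = (e : E →L[ℂ] E) ∘L
      (ContinuousLinearMap.id ℂ E + (e.symm : E →L[ℂ] E) ∘L R) := by
    ext x
    have : (e : E → E) x = (V : E →L[ℂ] E) x + (K x - R x) := by
      change (U : E →L[ℂ] E) x = _
      rw [hU]; rfl
    simp [this, add_assoc]
  obtain ⟨h1, h2⟩ := isFredholm_and_fredholmIndex_id_add_of_hasFiniteRange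
    (K := (e.symm : E →L[ℂ] E) ∘L R) (hR.comp_left ((e.symm : E →L[ℂ] E) : E →ₗ[ℂ] E))
  have h3 := e.isFredholm.comp h1
  rw [hdec]
  exact ⟨h3, by rw [fredholmIndex_comp e.isFredholm h1 h3, h2, fredholmIndex_equiv, add_zero]⟩

theorem isFredholm_and_fredholmIndex_of_compact_sub_one_sub [CompleteSpace E]
    {C : E →L[ℂ] E} (hC : ‖C‖ < 1)
    {A : E →L[ℂ] E} (hA : IsCompactOperator (A - (1 - C) : E →L[ℂ] E)) :
    A.IsFredholm ∧ fredholmIndex A = 0 := by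
  obtain ⟨U, hU⟩ := isUnit_one_sub_of_norm_lt_one hC
  have := isFredholm_and_fredholmIndex_unit_add_compact U hA
  rwa [hU, add_sub_cancel] at this

/-- Let `T'` be a contraction which is inverse to `T` modulo compact operators. If `‖C‖ < 1` and `B`
equals `T - C` modulo compact operators, then `T' B` and `B T'` are invertible plus compact, so `B`
is Fredholm, and its index depends on `T'` only. -/
theorem isFredholm_and_fredholmIndex_of_inverse_mod_compact [CompleteSpace E] [CompleteSpace F]
    {T : E →L[ℂ] F} {T' : F →L[ℂ] E} (hT' : ‖T'‖ ≤ 1)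
    (h₁ : IsCompactOperator (T' ∘L T - 1 : E →L[ℂ] E))
    (h₂ : IsCompactOperator (T ∘L T' - 1 : F →L[ℂ] F))
    {B C : E →L[ℂ] F} (hC : ‖C‖ < 1) (hB : IsCompactOperator (B - (T - C) : E →L[ℂ] F)) :
    B.IsFredholm ∧ fredholmIndex B = -fredholmIndex T' := by
  have hC₁ : ‖T' ∘L C‖ < 1 := by
    have := T'.opNorm_comp_le C
    nlinarith [norm_nonneg C, norm_nonneg T']
  have hC₂ : ‖C ∘L T'‖ < 1 := by
    have := C.opNorm_comp_le T'
    nlinarith [norm_nonneg C, norm_nonneg T']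
  have k₁ : (T' ∘L B).IsFredholm ∧ fredholmIndex (T' ∘L B) = 0 := by
    refine isFredholm_and_fredholmIndex_of_compact_sub_one_sub hC₁ ?_
    have : T' ∘L B - (1 - T' ∘L C) = T' ∘L (B - (T - C)) + (T' ∘L T - 1) := by
      ext x
      simp
      abel
    rw [this]
    exact (hB.clm_comp T').add h₁
  have k₂ : (B ∘L T').IsFredholm := by
    refine (isFredholm_and_fredholmIndex_of_compact_sub_one_sub hC₂ ?_).1
    have : B ∘L T' - (1 - C ∘L T') = (B - (T - C)) ∘L T' + (T ∘L T' - 1) := by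
      ext x
      simp
      abel
    rw [this]
    exact (hB.comp_clm T').add h₂
  have l₁ : (T' ∘L T).IsFredholm := by
    refine (isFredholm_and_fredholmIndex_of_compact_sub_one_sub (C := 0) (by simp) ?_).1
    simpa using h₁
  have l₂ : (T ∘L T').IsFredholm := by
    refine (isFredholm_and_fredholmIndex_of_compact_sub_one_sub (C := 0) (by simp) ?_).1
    simpa using h₂
  have hBF : B.IsFredholm := ContinuousLinearMap.IsFredholm.of_comp_of_comp k₁.1 k₂
  have hTF : T'.IsFredholm := ContinuousLinearMap.IsFredholm.of_comp_of_comp l₂ l₁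
  refine ⟨hBF, ?_⟩
  have := fredholmIndex_comp hTF hBF k₁.1
  rw [k₁.2] at this
  linarith

end Hilbert

/-! ### The Calkin norm -/

section Calkin

variable {E F E' F' : Type*} [NormedAddCommGroup E] [NormedSpace ℂ E]
  [NormedAddCommGroup F] [NormedSpace ℂ F] [NormedAddCommGroup E'] [NormedSpace ℂ E']
  [NormedAddCommGroup F'] [NormedSpace ℂ F']

theorem calkinNorm_zero : calkinNorm (0 : E →L[ℂ] F) = 0 := by
  rw [calkinNorm_eq_infDist]
  exact Metric.infDist_zero_of_mem (Submodule.zero_mem _)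

theorem exists_compact_sub_norm_lt {T : E →L[ℂ] F} {r : ℝ} (h : calkinNorm T < r) :
    ∃ T₁ : E →L[ℂ] F, IsCompactOperator (T - T₁ : E →L[ℂ] F) ∧ ‖T₁‖ < r := by
  rw [calkinNorm_eq_infDist, Metric.infDist_lt_iff ⟨0, Submodule.zero_mem _⟩] at h
  obtain ⟨K, hK, hd⟩ := h
  refine ⟨T - K, ?_, by rwa [← dist_eq_norm]⟩
  rw [sub_sub_cancel]
  exact hK

/-- If the product of the Calkin norms is less than one, then the two operators have compact
perturbations the product of whose norms is less than one. -/
theorem exists_compact_sub_norm_mul_lt_one {S : E →L[ℂ] F} {T : E' →L[ℂ] F'}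
    (h : calkinNorm S * calkinNorm T < 1) :
    ∃ (S₁ : E →L[ℂ] F) (T₁ : E' →L[ℂ] F'), IsCompactOperator (S - S₁ : E →L[ℂ] F) ∧
      IsCompactOperator (T - T₁ : E' →L[ℂ] F') ∧ ‖S₁‖ * ‖T₁‖ < 1 := by
  have hlim : Filter.Tendsto (fun ε : ℝ => (calkinNorm S + ε) * (calkinNorm T + ε))
      (nhdsWithin 0 (Set.Ioi 0)) (nhds (calkinNorm S * calkinNorm T)) := by
    refine Filter.Tendsto.mono_left (Continuous.tendsto' ?_ _ _ (by simp)) nhdsWithin_le_nhds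
    fun_prop
  obtain ⟨ε, hε, hε0⟩ := ((hlim.eventually_lt_const h).and self_mem_nhdsWithin).exists
  have hε0 : (0 : ℝ) < ε := hε0
  obtain ⟨S₁, hS, hS'⟩ := exists_compact_sub_norm_lt (lt_add_of_pos_right (calkinNorm S) hε0)
  obtain ⟨T₁, hT, hT'⟩ := exists_compact_sub_norm_lt (lt_add_of_pos_right (calkinNorm T) hε0)
  refine ⟨S₁, T₁, hS, hT, lt_of_le_of_lt ?_ hε⟩
  exact mul_le_mul hS'.le hT'.le (norm_nonneg _) ((norm_nonneg _).trans hS'.le)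

end Calkin

/-! ### Pairs of graph projections -/

section Graph

variable {H : Type*} [NormedAddCommGroup H] [InnerProductSpace ℂ H] {Y₀ Y₁ : Submodule ℂ H}

/-- The map `Y → H`, `x ↦ x + G x`, which parametrizes the graph of `G`. -/
noncomputable def graphMap (G : Y₁ →L[ℂ] Y₁ᗮ) : Y₁ →L[ℂ] H := Y₁.subtypeL + Y₁ᗮ.subtypeL ∘L G

theorem graphMap_mem (G : Y₁ →L[ℂ] Y₁ᗮ) (x : Y₁) : graphMap G x ∈ graphSubspace G := ⟨x, rfl⟩

theorem graphSubspace_zero : graphSubspace (0 : Y₁ →L[ℂ] Y₁ᗮ) = Y₁ := by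
  ext v
  simp [mem_graphSubspace]

variable [Y₀.HasOrthogonalProjection] [Y₁.HasOrthogonalProjection]

/-- The map `H → Yᗮ`, `v ↦ (1 - S) v - G S v`, where `S` is the projection onto `Y`. It measures how
far `v` is from lying on the graph of `G`, and its kernel is that graph. -/
noncomputable def graphDefect (G : Y₀ →L[ℂ] Y₀ᗮ) : H →L[ℂ] Y₀ᗮ :=
  Y₀ᗮ.orthogonalProjectionOnto - G ∘L Y₀.orthogonalProjectionOnto

theorem orthogonalProjectionOnto_graphMap (G : Y₁ →L[ℂ] Y₁ᗮ) (x : Y₁) :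
    Y₁.orthogonalProjectionOnto (graphMap G x) = x := by
  change Y₁.orthogonalProjectionOnto ((x : H) + (G x : H)) = x
  rw [map_add, orthogonalProjectionOnto_mem_subspace_eq_self,
    orthogonalProjectionOnto_eq_zero_iff.2 (G x).2, add_zero]

theorem coe_graphDefect (G : Y₀ →L[ℂ] Y₀ᗮ) (v : H) :
    (graphDefect G v : H) = v - graphMap G (Y₀.orthogonalProjectionOnto v) := by
  have : (Y₀ᗮ.orthogonalProjectionOnto v : H) = v - Y₀.orthogonalProjectionOnto v :=
    Y₀.starProjection_orthogonal_val v
  simp [graphDefect, graphMap, this, sub_sub]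

theorem graphDefect_graphMap (G : Y₀ →L[ℂ] Y₀ᗮ) (x : Y₀) : graphDefect G (graphMap G x) = 0 := by
  rw [← Subtype.coe_inj, coe_graphDefect, orthogonalProjectionOnto_graphMap, sub_self]
  rfl

theorem graphDefect_coe (G : Y₀ →L[ℂ] Y₀ᗮ) (z : Y₀ᗮ) : graphDefect G z = z := by
  rw [← Subtype.coe_inj, coe_graphDefect, orthogonalProjectionOnto_eq_zero_iff.2 z.2, map_zero,
    sub_zero]

variable [CompleteSpace H]

theorem graphDefect_one_sub_starProjection (G : Y₀ →L[ℂ] Y₀ᗮ) (v : H) :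
    graphDefect G ((1 - (graphSubspace G).starProjection : H →L[ℂ] H) v) = graphDefect G v := by
  obtain ⟨x, hx⟩ := (graphSubspace G).starProjection_apply_mem v
  have hx : graphMap G x = (graphSubspace G).starProjection v := hx
  change graphDefect G (v - (graphSubspace G).starProjection v) = _
  rw [← hx, map_sub, graphDefect_graphMap, sub_zero]

/-- The isomorphism `Y → Ran P`, `x ↦ x + G x`, where `P` is the projection onto the graph of `G`;
its inverse is the restriction of the projection onto `Y`. -/
noncomputable def equivRangeGraph (G : Y₁ →L[ℂ] Y₁ᗮ) :
    Y₁ ≃L[ℂ] LinearMap.range ((graphSubspace G).starProjection : H →ₗ[ℂ] H) :=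
  ContinuousLinearEquiv.equivOfInverse
    ((graphMap G).codRestrict _ fun x =>
      ⟨graphMap G x, starProjection_eq_self_iff.2 (graphMap_mem G x)⟩)
    (Y₁.orthogonalProjectionOnto ∘L (LinearMap.range _).subtypeL)
    (orthogonalProjectionOnto_graphMap G)
    (by
      rintro ⟨_, w, rfl⟩
      obtain ⟨x, hx⟩ := (graphSubspace G).starProjection_apply_mem w
      have hx : graphMap G x = (graphSubspace G).starProjection w := hx
      refine Subtype.ext ?_
      change graphMap G (Y₁.orthogonalProjectionOnto ((graphSubspace G).starProjection w)) =
        (graphSubspace G).starProjection w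
      rw [← hx, orthogonalProjectionOnto_graphMap])

/-- The restriction of `graphDefect G` as an isomorphism `Ran (1 - P) → Yᗮ`, where `P` is the
projection onto the graph of `G`; its inverse is the restriction of `1 - P`. -/
noncomputable def rangeOneSubGraphEquiv (G : Y₀ →L[ℂ] Y₀ᗮ) :
    LinearMap.range ((1 - (graphSubspace G).starProjection : H →L[ℂ] H) : H →ₗ[ℂ] H) ≃L[ℂ] Y₀ᗮ :=
  ContinuousLinearEquiv.equivOfInverse
    (graphDefect G ∘L (LinearMap.range _).subtypeL)
    (((1 - (graphSubspace G).starProjection : H →L[ℂ] H) ∘L Y₀ᗮ.subtypeL).codRestrict _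
      fun z => ⟨z, rfl⟩)
    (by
      rintro ⟨_, w, rfl⟩
      refine Subtype.ext ?_
      set P := (graphSubspace G).starProjection
      have hP : ∀ v ∈ graphSubspace G, P v = v := fun v hv => starProjection_eq_self_iff.2 hv
      change (graphDefect G ((1 - P : H →L[ℂ] H) w) : H) - P (graphDefect G ((1 - P : H →L[ℂ] H) w))
        = w - P w
      -- `graphDefect G w` differs from `w` by a vector of the graph, on which `1 - P` vanishes.
      rw [graphDefect_one_sub_starProjection, coe_graphDefect, map_sub, hP _ (graphMap_mem G _)]
      abel)
    (by
      intro z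
      exact (graphDefect_one_sub_starProjection G z).trans (graphDefect_coe G z))

/-- The operator of the pair `(P₁, 1 - P₀)` is isomorphic to `graphDefect G₀ ∘ graphMap G₁`, an
operator from `Y₁` to `Y₀ᗮ`. -/
theorem pairOperator_graph_eq (G₀ : Y₀ →L[ℂ] Y₀ᗮ) (G₁ : Y₁ →L[ℂ] Y₁ᗮ) :
    pairOperator (graphSubspace G₁).starProjection (1 - (graphSubspace G₀).starProjection) =
      ((rangeOneSubGraphEquiv G₀).symm : _ →L[ℂ] _) ∘L (graphDefect G₀ ∘L graphMap G₁) ∘L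
        ((equivRangeGraph G₁).symm : _ →L[ℂ] _) := by
  refine ContinuousLinearMap.ext fun v => ?_
  obtain ⟨x, rfl⟩ := (equivRangeGraph G₁).surjective v
  have h : (equivRangeGraph G₁).symm (equivRangeGraph G₁ x) = x :=
    (equivRangeGraph G₁).symm_apply_apply x
  change _ = (rangeOneSubGraphEquiv G₀).symm
    (graphDefect G₀ (graphMap G₁ ((equivRangeGraph G₁).symm (equivRangeGraph G₁ x))))
  rw [h, ContinuousLinearEquiv.eq_symm_apply]
  exact graphDefect_one_sub_starProjection G₀ (graphMap G₁ x)

theorem isFredholm_and_fredholmIndex_pairOperator_graph {G₀ : Y₀ →L[ℂ] Y₀ᗮ} {G₁ : Y₁ →L[ℂ] Y₁ᗮ}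
    (h : (graphDefect G₀ ∘L graphMap G₁).IsFredholm) :
    (pairOperator (graphSubspace G₁).starProjection
      (1 - (graphSubspace G₀).starProjection)).IsFredholm ∧
    pairIndex (graphSubspace G₁).starProjection (1 - (graphSubspace G₀).starProjection) =
      fredholmIndex (graphDefect G₀ ∘L graphMap G₁) := by
  have h₁ := (equivRangeGraph G₁).symm.isFredholm
  have h₀ := (rangeOneSubGraphEquiv G₀).symm.isFredholm
  rw [pairIndex, pairOperator_graph_eq]
  refine ⟨h₀.comp (h.comp h₁), ?_⟩
  rw [fredholmIndex_comp h₀ (h.comp h₁) (h₀.comp (h.comp h₁)), fredholmIndex_comp h h₁ (h.comp h₁),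
    fredholmIndex_equiv, fredholmIndex_equiv, zero_add, add_zero]

theorem starProjection_graphSubspace_zero :
    (graphSubspace (0 : Y₁ →L[ℂ] Y₁ᗮ)).starProjection = Y₁.starProjection := by
  congr 1
  exact graphSubspace_zero

/-- The index of `(P₁, 1 - P₀)` is minus the index of the operator `Y₀ᗮ → Y₁`, `z ↦ S₁ z`, which
does not involve `G₀` and `G₁`. -/
theorem isFredholmPair_graph_and_pairIndex_graph
    (hS : IsCompactOperator (1 - Y₁.starProjection - Y₀.starProjection : H →L[ℂ] H))
    (G₀ : Y₀ →L[ℂ] Y₀ᗮ) (G₁ : Y₁ →L[ℂ] Y₁ᗮ)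
    (hG : calkinNorm G₀ * calkinNorm G₁ < 1) :
    IsFredholmPair (graphSubspace G₁).starProjection (1 - (graphSubspace G₀).starProjection) ∧
    pairIndex (graphSubspace G₁).starProjection (1 - (graphSubspace G₀).starProjection) =
      -fredholmIndex (Y₁.orthogonalProjectionOnto ∘L Y₀ᗮ.subtypeL) := by
  have : CompleteSpace Y₁ := by
    rw [← Y₁.orthogonal_orthogonal]
    infer_instance
  set J : H →L[ℂ] H := 1 - Y₁.starProjection - Y₀.starProjection
  have hJv (v : H) : J v = v - Y₁.orthogonalProjectionOnto v - Y₀.orthogonalProjectionOnto v := rfl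
  have hp (v : H) : (Y₀ᗮ.orthogonalProjectionOnto v : H) = v - Y₀.orthogonalProjectionOnto v :=
    Y₀.starProjection_orthogonal_val v
  have hY₁ (x : Y₁) : Y₁.orthogonalProjectionOnto (x : H) = x :=
    orthogonalProjectionOnto_mem_subspace_eq_self x
  have hZ₁ (z : Y₁ᗮ) : Y₁.orthogonalProjectionOnto (z : H) = 0 :=
    orthogonalProjectionOnto_eq_zero_iff.2 z.2
  have hZ₀ (z : Y₀ᗮ) : Y₀.orthogonalProjectionOnto (z : H) = 0 :=
    orthogonalProjectionOnto_eq_zero_iff.2 z.2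
  have hpp (v : H) : Y₀ᗮ.orthogonalProjectionOnto (Y₀.orthogonalProjectionOnto v : H) = 0 :=
    orthogonalProjectionOnto_orthogonal_apply_eq_zero (Y₀.orthogonalProjectionOnto v).2
  have hYY (v : Y₀) : Y₀.orthogonalProjectionOnto (v : H) = v :=
    orthogonalProjectionOnto_mem_subspace_eq_self v
  have hZZ (v : Y₀ᗮ) : Y₀ᗮ.orthogonalProjectionOnto (v : H) = v :=
    orthogonalProjectionOnto_mem_subspace_eq_self v
  obtain ⟨C₀, C₁, hC₀, hC₁, hC⟩ := exists_compact_sub_norm_mul_lt_one hG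
  -- `p`, `q`, `r` are `1 - S₀`, `S₀`, `S₁`, with values in the subspaces themselves.
  set p := Y₀ᗮ.orthogonalProjectionOnto with hp_def
  set q := Y₀.orthogonalProjectionOnto with hq_def
  set r := Y₁.orthogonalProjectionOnto
  let T : Y₁ →L[ℂ] Y₀ᗮ := p ∘L Y₁.subtypeL
  let T' : Y₀ᗮ →L[ℂ] Y₁ := r ∘L Y₀ᗮ.subtypeL
  have hT' : ‖T'‖ ≤ 1 := by
    refine (ContinuousLinearMap.opNorm_comp_le _ _).trans ?_
    exact mul_le_one₀ Y₁.orthogonalProjectionOnto_norm_le (norm_nonneg _)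
      (Submodule.norm_subtypeL_le _)
  let C : Y₁ →L[ℂ] Y₀ᗮ := C₀ ∘L (q ∘L Y₁ᗮ.subtypeL) ∘L C₁
  have hCn : ‖C‖ < 1 := by
    have hq : ‖q ∘L Y₁ᗮ.subtypeL‖ ≤ 1 := (ContinuousLinearMap.opNorm_comp_le _ _).trans
      (mul_le_one₀ Y₀.orthogonalProjectionOnto_norm_le (norm_nonneg _)
        (Submodule.norm_subtypeL_le _))
    refine lt_of_le_of_lt ?_ hC
    calc ‖C‖ ≤ ‖C₀‖ * (‖q ∘L Y₁ᗮ.subtypeL‖ * ‖C₁‖) :=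
          (ContinuousLinearMap.opNorm_comp_le _ _).trans
            (by gcongr; exact ContinuousLinearMap.opNorm_comp_le _ _)
      _ ≤ ‖C₀‖ * (1 * ‖C₁‖) := by gcongr
      _ = ‖C₀‖ * ‖C₁‖ := by rw [one_mul]
  have h₁ : IsCompactOperator (T' ∘L T - 1 : Y₁ →L[ℂ] Y₁) := by
    have e : T' ∘L T - 1 = r ∘L (J ∘L Y₁.subtypeL) := by
      ext x
      simp [T, T', hJv, hp, hY₁]
    rw [e]
    exact (hS.comp_clm Y₁.subtypeL).clm_comp r
  have h₂ : IsCompactOperator (T ∘L T' - 1 : Y₀ᗮ →L[ℂ] Y₀ᗮ) := by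
    have e : T ∘L T' - 1 = -(p ∘L (J ∘L Y₀ᗮ.subtypeL)) := by
      refine ContinuousLinearMap.ext fun z => ?_
      simp [T, T', hJv, hZ₀, hZZ]
    rw [e]
    exact ((hS.comp_clm Y₀ᗮ.subtypeL).clm_comp p).neg
  -- `(1 - S₀) G₁` and `S₀` restricted to `Y₁` are compact, as `J` is `1 - S₀` on `Y₁ᗮ` and `-S₀` on
  -- `Y₁`; hence only `(1 - S₀) x` and `-G₀ S₀ G₁ x` survive modulo compact operators.
  have k₁ : IsCompactOperator (p ∘L (J ∘L (Y₁ᗮ.subtypeL ∘L G₁))) :=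
    (hS.comp_clm (Y₁ᗮ.subtypeL ∘L G₁)).clm_comp p
  have k₂ : IsCompactOperator (G₀ ∘L (q ∘L (J ∘L Y₁.subtypeL))) :=
    ((hS.comp_clm Y₁.subtypeL).clm_comp q).clm_comp G₀
  have k₃ : IsCompactOperator ((G₀ - C₀) ∘L (q ∘L (Y₁ᗮ.subtypeL ∘L G₁))) :=
    hC₀.comp_clm (q ∘L (Y₁ᗮ.subtypeL ∘L G₁))
  have k₄ : IsCompactOperator ((C₀ ∘L (q ∘L Y₁ᗮ.subtypeL)) ∘L (G₁ - C₁)) :=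
    hC₁.clm_comp (C₀ ∘L (q ∘L Y₁ᗮ.subtypeL))
  have hB : IsCompactOperator (graphDefect G₀ ∘L graphMap G₁ - (T - C) : Y₁ →L[ℂ] Y₀ᗮ) := by
    have e : graphDefect G₀ ∘L graphMap G₁ - (T - C) =
        p ∘L (J ∘L (Y₁ᗮ.subtypeL ∘L G₁)) + G₀ ∘L (q ∘L (J ∘L Y₁.subtypeL))
          - ((G₀ - C₀) ∘L (q ∘L (Y₁ᗮ.subtypeL ∘L G₁))
            + (C₀ ∘L (q ∘L Y₁ᗮ.subtypeL)) ∘L (G₁ - C₁)) := by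
      refine ContinuousLinearMap.ext fun x => ?_
      change p ((x : H) + G₁ x) - G₀ (q ((x : H) + G₁ x)) - (p x - C₀ (q (C₁ x))) =
        p (J (G₁ x)) + G₀ (q (J x)) -
          ((G₀ (q (G₁ x)) - C₀ (q (G₁ x))) + C₀ (q ((G₁ x - C₁ x : Y₁ᗮ) : H)))
      rw [hJv, hJv, hZ₁, hY₁]
      simp only [map_add, map_sub, hpp, hYY, Submodule.coe_sub, ZeroMemClass.coe_zero,
        sub_self, zero_sub, sub_zero, map_neg]
      abel
    rw [e]
    exact (k₁.add k₂).sub (k₃.add k₄)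
  obtain ⟨hF, hi⟩ := isFredholm_and_fredholmIndex_of_inverse_mod_compact hT' h₁ h₂ hCn hB
  obtain ⟨hF', hi'⟩ := isFredholm_and_fredholmIndex_pairOperator_graph hF
  exact ⟨⟨isStarProjection_starProjection, isStarProjection_starProjection.one_sub, hF'⟩,
    hi'.trans hi⟩

end Graph

theorem mainTheorem4 {H : Type*} [NormedAddCommGroup H] [InnerProductSpace ℂ H] [CompleteSpace H]
    (Y₀ Y₁ : Submodule ℂ H) [Y₀.HasOrthogonalProjection] [Y₁.HasOrthogonalProjection]
    (hS : IsCompactOperator (1 - Y₁.starProjection - Y₀.starProjection : H →L[ℂ] H))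
    (G₀ : Y₀ →L[ℂ] Y₀ᗮ) (G₁ : Y₁ →L[ℂ] Y₁ᗮ)
    (hG : calkinNorm G₀ * calkinNorm G₁ < 1) :
    IsFredholmPair (graphSubspace G₁).starProjection (1 - (graphSubspace G₀).starProjection) ∧
    IsFredholmPair Y₁.starProjection (1 - Y₀.starProjection) ∧
    pairIndex (graphSubspace G₁).starProjection (1 - (graphSubspace G₀).starProjection) =
      pairIndex Y₁.starProjection (1 - Y₀.starProjection) := by
  -- The unperturbed pair is the case `G₀ = G₁ = 0`, since the graph of `0 : Y → Yᗮ` is `Y`.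
  obtain ⟨hP, iP⟩ := isFredholmPair_graph_and_pairIndex_graph hS G₀ G₁ hG
  obtain ⟨hQ, iQ⟩ := isFredholmPair_graph_and_pairIndex_graph hS 0 0 (by simp [calkinNorm_zero])
  rw [starProjection_graphSubspace_zero, starProjection_graphSubspace_zero] at hQ iQ
  exact ⟨hP, hQ, iP.trans iQ.symm⟩
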